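/- \textbf{Setting.} Let $u^+,u^-:\mathbb R\to[0,\infty)$ be continuous utility functions: $u^+(x)=0$ for $x\le 0$, $u^+$ is increasing and differentiable on $(0,\infty)$ with $k^+\le |(u^+)'|\le K^+$ there; $u^-(x)=0$ for $x\ge 0$, $u^-$ is decreasing and differentiable on $(-\infty,0)$ with $k^-\le |(u^-)'|\le K^-$ there; here $k^\pm,K^\pm>0$. Let $w^+,w^-:[0,1]\to[0,1]$ be continuous and nondecreasing with $w^\pm(0)=0$, $w^\pm(1)=1$ and $|w^\pm(p)-w^\pm(q)|\le L|p-q|^{\alpha}$ for all $p,q\in[0,1]$, where $L>0$ and $0<\alpha<1$. The CPT-value of a real random variable $X$ (or of its distribution) is $$C(X)=\int_0^\infty w^+\big(P(u^+(X)>z)\big)\,dz-\int_0^\infty w^-\big(P(u^-(X)>z)\big)\,dz .$$ For a CDF $F$ and $\tau>0$ let $F|_\tau$ be the CDF $F|_\tau(x)=F(x)\mathbf 1\{-\tau\le x<\tau\}+\mathbf 1\{x\ge\tau\}$. Let $X$ be sub-Gaussian with parameter $\sigma>0$, that is, $E\exp(\gamma X^2)\le 2$ for some $\gamma>0$, and $P(|X|\ge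 t)\le 2\exp(-t^2/(2\sigma^2))$ for all $t>0$ (this holds in particular if $E\exp(X^2/(2\sigma^2))\le 2$). Let $F_n$ be the empirical distribution function of $n$ i.i.d. samples of $X$, put $$\tau_n=\max\Big(\tfrac{K^+}{k^+},\tfrac{K^-}{k^-}\Big)\big(\sigma\sqrt{\log n}+1\big),$$ and let $C_n=C(F_n|_{\tau_n})$ be the truncated CPT estimator. Let $1<\beta\le 2$ (for sub-Gaussian $X$ the natural choice is $\beta=2$), and for $n\ge 2$ let $$c_3(n)=\frac{L(K^++K^-)}{(\log n)^{\frac{\beta}{\beta-1}}\,\alpha(1-\alpha)(\beta-1)\,n^{\alpha(1-\alpha)}} .$$ \textbf{Proposition.} Both integrals defining $C(X)$ are finite, and there are constants $c_1,c_2>0$ depending only on $\sigma$ and $\alpha$ such that, for every $n\ge 2$ and every $\epsilon>c_3(n)$, $$P\big(|C_n-C(X)|>\epsilon\big)\le c_1\exp\left(-c_2\,n\left(\frac{\epsilon-c_3(n)}{L(K^++K^-)\max\big(\frac{K^+}{k^+},\frac{K^-}{k^-}\big)(\log n)^{1/\beta}}\right)^{2/\alpha}\right).$$ The bias term decays polynomially: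 $c_3(n)=O\big(n^{-\alpha(1-\alpha)}\big)$ as $n\to\infty$. -/

import Mathlib

open MeasureTheory ProbabilityTheory Set

/-- A utility function for gains: nonnegative, continuous, zero on `(-∞, 0]`, increasing and
differentiable on `(0, ∞)`, with derivative there between `k` and `K` in absolute value. -/
structure IsGainUtility (u : ℝ → ℝ) (k K : ℝ) : Prop where
  lower_pos : 0 < k
  upper_pos : 0 < K
  nonneg : ∀ x, 0 ≤ u x
  continuous : Continuous u
  eq_zero : ∀ x ≤ 0, u x = 0
  increasing : MonotoneOn u (Ioi 0)
  differentiable : ∀ x > 0, DifferentiableAt ℝ u x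
  le_deriv : ∀ x > 0, k ≤ |deriv u x|
  deriv_le : ∀ x > 0, |deriv u x| ≤ K

/-- A utility function for losses: nonnegative, continuous, zero on `[0, ∞)`, decreasing and
differentiable on `(-∞, 0)`, with derivative there between `k` and `K` in absolute value. -/
structure IsLossUtility (u : ℝ → ℝ) (k K : ℝ) : Prop where
  lower_pos : 0 < k
  upper_pos : 0 < K
  nonneg : ∀ x, 0 ≤ u x
  continuous : Continuous u
  eq_zero : ∀ x, 0 ≤ x → u x = 0
  decreasing : AntitoneOn u (Iio 0)
  differentiable : ∀ x < 0, DifferentiableAt ℝ u x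
  le_deriv : ∀ x < 0, k ≤ |deriv u x|
  deriv_le : ∀ x < 0, |deriv u x| ≤ K

/-- A probability weight function `[0,1] → [0,1]` (only its values on `[0,1]` matter): continuous,
nondecreasing, fixing `0` and `1`, and Hölder continuous with exponent `α` and constant `L`. -/
structure IsWeightFunction (w : ℝ → ℝ) (α L : ℝ) : Prop where
  mapsTo : MapsTo w (Icc 0 1) (Icc 0 1)
  continuousOn : ContinuousOn w (Icc 0 1)
  monotoneOn : MonotoneOn w (Icc 0 1)
  map_zero : w 0 = 0
  map_one : w 1 = 1
  holder : ∀ p ∈ Icc (0 : ℝ) 1, ∀ q ∈ Icc (0 : ℝ) 1, |w p - w q| ≤ L * |p - q| ^ α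

/-- The integrand `z ↦ w (P(u(X) > z))`, where `ν` is the distribution of `X`. -/
noncomputable def weightedTail (u w : ℝ → ℝ) (ν : Measure ℝ) (z : ℝ) : ℝ :=
  w (ν.real {x | z < u x})

/-- The CPT-value of a distribution `ν` on `ℝ`:
`∫₀^∞ w⁺(P(u⁺(X) > z)) dz - ∫₀^∞ w⁻(P(u⁻(X) > z)) dz` for `X` distributed according to `ν`. -/
noncomputable def cptValue (up um wp wm : ℝ → ℝ) (ν : Measure ℝ) : ℝ :=
  (∫ z in Ioi (0 : ℝ), weightedTail up wp ν z) - ∫ z in Ioi (0 : ℝ), weightedTail um wm ν z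

/-- The empirical distribution of a sample `x₁, …, xₙ`. -/
noncomputable def empiricalMeasure {n : ℕ} (x : Fin n → ℝ) : Measure ℝ :=
  (n : ENNReal)⁻¹ • ∑ i, Measure.dirac (x i)

/-- The truncation of a distribution at level `τ`: if `F` is the CDF of `ν`, then the CDF of
`truncateDistribution τ ν` is `F|_τ(x) = F(x) 1{-τ ≤ x < τ} + 1{x ≥ τ}`,
see `cdf_truncateDistribution`. -/
noncomputable def truncateDistribution (τ : ℝ) (ν : Measure ℝ) : Measure ℝ :=
  ν.map fun x => max (-τ) (min τ x)

theorem cdf_truncateDistribution {τ : ℝ} (hτ : 0 < τ) (ν : Measure ℝ) [IsProbabilityMeasure ν]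
    (x : ℝ) :
    cdf (truncateDistribution τ ν) x
      = (Ico (-τ) τ).indicator (fun y => cdf ν y) x + (Ici τ).indicator 1 x := by
  have hm : Measurable fun x : ℝ => max (-τ) (min τ x) := by fun_prop
  have : IsProbabilityMeasure (truncateDistribution τ ν) :=
    Measure.isProbabilityMeasure_map hm.aemeasurable
  rw [cdf_eq_real, truncateDistribution, map_measureReal_apply hm measurableSet_Iic]
  have hset : (fun x : ℝ => max (-τ) (min τ x)) ⁻¹' Iic x
      = if x < -τ then ∅ else if x < τ then Iic x else univ := by
    ext y
    split_ifs with h1 h2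
    · simp [h1]
    · simp [not_lt.1 h1, h2]
    · simp [not_lt.1 h1, not_lt.1 h2]
  rw [hset]
  split_ifs with h1 h2
  · have h3 : ¬ τ ≤ x := by linarith
    simp [indicator, h1, h3]
  · simp [indicator, not_lt.1 h1, h2, cdf_eq_real]
  · simp [indicator, h2, not_lt.1 h2]

/-- The random variable `X` is sub-Gaussian, `E exp(γ X²) ≤ 2` for some `γ > 0`, with parameter
`σ`, the scale in its Gaussian tail bound. -/
structure IsSubGaussian {Ω : Type*} [MeasurableSpace Ω] (X : Ω → ℝ) (μ : Measure Ω) (σ : ℝ) :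
    Prop where
  param_pos : 0 < σ
  expMoment : ∃ γ > 0, ∫⁻ ω, ENNReal.ofReal (Real.exp (γ * X ω ^ 2)) ∂μ ≤ 2
  tail : ∀ t > 0, μ.real {ω | t ≤ |X ω|} ≤ 2 * Real.exp (-t ^ 2 / (2 * σ ^ 2))

/-- The truncation level `τₙ = max(K⁺/k⁺, K⁻/k⁻) (σ √(log n) + 1)`. -/
noncomputable def truncationLevel (kp Kp km Km σ : ℝ) (n : ℕ) : ℝ :=
  max (Kp / kp) (Km / km) * (σ * √(Real.log n) + 1)

/-- The truncated CPT-value estimator `Cₙ = C(Fₙ|_τ)`, with `Fₙ` the empirical distribution of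
the sample. -/
noncomputable def cptEstimator (up um wp wm : ℝ → ℝ) (τ : ℝ) {n : ℕ} (x : Fin n → ℝ) : ℝ :=
  cptValue up um wp wm (truncateDistribution τ (empiricalMeasure x))

/-- The bias term
`c₃(n) = L (K⁺ + K⁻) / ((log n)^(β/(β-1)) α (1-α) (β-1) n^(α(1-α)))`. -/
noncomputable def cptBias (L Kp Km α β : ℝ) (n : ℕ) : ℝ :=
  L * (Kp + Km) /
    (Real.log n ^ (β / (β - 1)) * (α * (1 - α)) * (β - 1) * (n : ℝ) ^ (α * (1 - α)))

/-! Clipping the samples at `τ` cuts each integral at a level `a ∈ [k τ, K τ]`. Hölder continuity of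
the weight then splits the error into `L ∫ |Fₙ - F|^α` over levels in `(0, K τ)` and the discarded
tail of the true integral. By the choice of `τ`, `a ≥ K σ √(log n)`, so the Gaussian tail raised to
the power `α` leaves at most a constant times `L K n^(-α/2)`.

The fluctuation is not controlled uniformly in the level. Hoeffding's inequality at a fixed level is
put in the form `E exp(n (Fₙ - F)²) ≤ 2`. Since `y ↦ exp(n y^(2/α))` is convex, Jensen's inequality
carries this bound over to the level average of `|Fₙ - F|^α`, and Markov's inequality gives the
deviation estimate (`measure_integral_abs_rpow_ge_le`).

The truncation error is not compared with `c₃(n)`, about which only `c₃(n) ≥ 0` is needed. If `ε`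
exceeds twice the truncation error, half of `ε` is left for the fluctuation. Otherwise `n ε^(2/α)`
is bounded up to scaling, and `c₁` is large enough to make the claimed bound at least `1`. -/

/-! ### Utility functions under clipping. -/

/-- The properties of a utility function that the truncation argument uses: it grows at most
linearly, and clipping its argument at level `τ` amounts to clipping its value at a level
between `k τ` and `K τ`. -/
structure IsTruncatableUtility (u : ℝ → ℝ) (k K : ℝ) : Prop where
  lower_pos : 0 < k
  lower_le_upper : k ≤ K
  nonneg : ∀ x, 0 ≤ u x
  continuous : Continuous u
  le_mul_abs : ∀ x, u x ≤ K * |x|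
  clip : ∀ τ > 0, ∃ a, k * τ ≤ a ∧ a ≤ K * τ ∧ ∀ x, u (max (-τ) (min τ x)) = min (u x) a

theorem IsGainUtility.monotone {u : ℝ → ℝ} {k K : ℝ} (h : IsGainUtility u k K) : Monotone u := by
  intro x y hxy
  rcases le_or_gt x 0 with hx | hx
  · rw [h.eq_zero x hx]; exact h.nonneg y
  · exact h.increasing hx (hx.trans_le hxy) hxy

/-- Monotonicity removes the absolute value from the derivative bounds, so the mean value inequality
gives `k x ≤ u x ≤ K x` for `x ≥ 0`. A monotone function commutes with `min` and `max`, hence the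
clipping level is `a = u τ`. -/
theorem IsGainUtility.isTruncatableUtility {u : ℝ → ℝ} {k K : ℝ} (h : IsGainUtility u k K) :
    IsTruncatableUtility u k K := by
  have hmono := h.monotone
  have hd0 : ∀ x > 0, 0 ≤ deriv u x := fun x _ => hmono.deriv_nonneg
  have h1 : ∀ x > 0, k ≤ deriv u x := fun x hx => by
    simpa [abs_of_nonneg (hd0 x hx)] using h.le_deriv x hx
  have h2 : ∀ x > 0, deriv u x ≤ K := fun x hx => by
    simpa [abs_of_nonneg (hd0 x hx)] using h.deriv_le x hx
  have hdiff : DifferentiableOn ℝ u (interior (Ici 0)) := by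
    rw [interior_Ici]
    exact fun x hx => (h.differentiable x hx).differentiableWithinAt
  have h0 : u 0 = 0 := h.eq_zero 0 le_rfl
  have hlow : ∀ x, 0 ≤ x → k * x ≤ u x := fun x hx => by
    have := (convex_Ici (0 : ℝ)).mul_sub_le_image_sub_of_le_deriv h.continuous.continuousOn hdiff
      (C := k) (by simpa using h1) 0 self_mem_Ici x hx hx
    simpa [h0] using this
  have hup : ∀ x, 0 ≤ x → u x ≤ K * x := fun x hx => by
    have := (convex_Ici (0 : ℝ)).image_sub_le_mul_sub_of_deriv_le h.continuous.continuousOn hdiff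
      (C := K) (by simpa using h2) 0 self_mem_Ici x hx hx
    simpa [h0] using this
  refine ⟨h.lower_pos, (h.le_deriv 1 one_pos).trans (h.deriv_le 1 one_pos), h.nonneg,
    h.continuous, fun x => (hmono (le_abs_self x)).trans (hup _ (abs_nonneg x)), fun τ hτ =>
    ⟨u τ, hlow τ hτ.le, hup τ hτ.le, fun x => ?_⟩⟩
  rw [hmono.map_max, hmono.map_min, h.eq_zero (-τ) (by linarith), min_comm,
    max_eq_right (le_min (h.nonneg _) (h.nonneg _))]

theorem IsLossUtility.isGainUtility_comp_neg {u : ℝ → ℝ} {k K : ℝ} (h : IsLossUtility u k K) :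
    IsGainUtility (fun x => u (-x)) k K where
  lower_pos := h.lower_pos
  upper_pos := h.upper_pos
  nonneg x := h.nonneg _
  continuous := h.continuous.comp continuous_neg
  eq_zero x hx := h.eq_zero _ (by linarith)
  increasing x hx y hy hxy := h.decreasing (by simpa using hy) (by simpa using hx) (by linarith)
  differentiable x hx :=
    (h.differentiable (-x) (by linarith)).comp x differentiable_neg.differentiableAt
  le_deriv x hx := by simpa [deriv_comp_neg] using h.le_deriv (-x) (by linarith)
  deriv_le x hx := by simpa [deriv_comp_neg] using h.deriv_le (-x) (by linarith)

theorem IsLossUtility.isTruncatableUtility {u : ℝ → ℝ} {k K : ℝ} (h : IsLossUtility u k K) :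
    IsTruncatableUtility u k K := by
  have hg := h.isGainUtility_comp_neg.isTruncatableUtility
  refine ⟨hg.lower_pos, hg.lower_le_upper, h.nonneg, h.continuous,
    fun x => by simpa using hg.le_mul_abs (-x), fun τ hτ => ?_⟩
  obtain ⟨a, h1, h2, h3⟩ := hg.clip τ hτ
  refine ⟨a, h1, h2, fun x => ?_⟩
  -- Clipping to a symmetric interval is odd, so the gain case transfers under reflection.
  have hclip : -max (-τ) (min τ (-x)) = max (-τ) (min τ x) := by
    rw [← min_neg_neg, ← max_neg_neg]
    simp only [neg_neg]
    rw [min_max_distrib_left, min_eq_right (show -τ ≤ τ by linarith)]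
  simpa [hclip] using h3 (-x)

/-! ### Square-exponential moments and Hoeffding's inequality. -/

theorem lintegral_exp_sq_div_four_gaussianReal_le :
    ∫⁻ g, ENNReal.ofReal (Real.exp (g ^ 2 / 4)) ∂(gaussianReal 0 1) ≤ 2 := by
  rw [gaussianReal_of_var_ne_zero 0 one_ne_zero,
    lintegral_withDensity_eq_lintegral_mul _ (measurable_gaussianPDF 0 1) (by fun_prop)]
  have hpt : ∀ g : ℝ, (gaussianPDF 0 1 * fun g => ENNReal.ofReal (Real.exp (g ^ 2 / 4))) g
      = ENNReal.ofReal ((√(2 * Real.pi))⁻¹ * Real.exp (-(1 / 4) * g ^ 2)) := fun g => by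
    rw [Pi.mul_apply, gaussianPDF, ← ENNReal.ofReal_mul (gaussianPDFReal_nonneg _ _ _),
      gaussianPDFReal, mul_assoc, ← Real.exp_add]
    simp only [NNReal.coe_one, mul_one, sub_zero]
    ring_nf
  simp_rw [hpt]
  rw [← ofReal_integral_eq_lintegral_ofReal
    ((integrable_exp_neg_mul_sq (by norm_num)).const_mul _) (ae_of_all _ fun g => by positivity),
    integral_const_mul, integral_gaussian, ← ENNReal.ofReal_ofNat]
  refine ENNReal.ofReal_le_ofReal ?_
  rw [← div_eq_inv_mul, div_le_iff₀ (by positivity)]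
  refine Real.sqrt_le_iff.2 ⟨by positivity, ?_⟩
  rw [mul_pow, Real.sq_sqrt (by positivity)]
  linarith [Real.pi_pos]

/-- A sub-Gaussian variable has a square-exponential moment. -/
theorem ProbabilityTheory.HasSubgaussianMGF.lintegral_exp_sq_le {Ω : Type*}
    [MeasurableSpace Ω] {P : Measure Ω} [SFinite P] {Y : Ω → ℝ} {c : NNReal} (hY : HasSubgaussianMGF Y c P)
    (hm : Measurable Y) {s : ℝ} (hs : c * s ^ 2 ≤ 1 / 2) :
    ∫⁻ ω, ENNReal.ofReal (Real.exp ((s * Y ω) ^ 2 / 2)) ∂P ≤ 2 := by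
  -- Linearize the square with an auxiliary standard Gaussian `g`: `exp(t²/2) = E exp(t g)`. After
  -- swapping the integrals, the moment generating function bound leaves at most `E exp(g²/4)`.
  have hlin : ∀ t : ℝ, ENNReal.ofReal (Real.exp (t ^ 2 / 2))
      = ∫⁻ g, ENNReal.ofReal (Real.exp (t * g)) ∂(gaussianReal 0 1) := fun t => by
    rw [← ofReal_integral_eq_lintegral_ofReal (integrable_exp_mul_gaussianReal t)
      (ae_of_all _ fun g => (Real.exp_pos _).le)]
    have := mgf_gaussianReal (p := gaussianReal 0 1) (X := id) (μ := 0) (v := 1) (by simp) t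
    simp only [mgf, id] at this
    rw [this]
    simp
  simp_rw [hlin]
  rw [lintegral_lintegral_swap (by fun_prop)]
  refine (lintegral_mono fun g => ?_).trans lintegral_exp_sq_div_four_gaussianReal_le
  have hint := hY.integrable_exp_mul (s * g)
  have hmgf := hY.mgf_le (s * g)
  simp only [mgf] at hmgf
  simp_rw [mul_right_comm s _ g]
  rw [← ofReal_integral_eq_lintegral_ofReal hint (ae_of_all _ fun g => (Real.exp_pos _).le)]
  refine ENNReal.ofReal_le_ofReal (hmgf.trans (Real.exp_le_exp.2 ?_))
  nlinarith [sq_nonneg g, mul_le_mul_of_nonneg_right hs (sq_nonneg g)]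

theorem empiricalMeasure_real_apply {n : ℕ} (x : Fin n → ℝ) {B : Set ℝ} (hB : MeasurableSet B) :
    (empiricalMeasure x).real B = (n : ℝ)⁻¹ * ∑ i, B.indicator 1 (x i) := by
  rw [empiricalMeasure, measureReal_ennreal_smul_apply, measureReal_def,
    Measure.finsetSum_apply, ENNReal.toReal_sum (fun i _ => measure_ne_top _ _)]
  congr 1
  · simp
  · refine Finset.sum_congr rfl fun i _ => ?_
    rw [Measure.dirac_apply' _ hB]
    by_cases h : x i ∈ B <;> simp [h]

instance isProbabilityMeasure_empiricalMeasure {n : ℕ} [NeZero n] (x : Fin n → ℝ) :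
    IsProbabilityMeasure (empiricalMeasure x) := by
  constructor
  simp [empiricalMeasure, ENNReal.inv_mul_cancel, NeZero.ne n]

/-- Hoeffding's inequality for the empirical measure of a set, as a bound on a square-exponential
moment. -/
theorem lintegral_exp_sq_empiricalMeasure_sub_le {n : ℕ} [NeZero n] (ν : Measure ℝ)
    [IsProbabilityMeasure ν] {B : Set ℝ} (hB : MeasurableSet B) :
    ∫⁻ x : Fin n → ℝ, ENNReal.ofReal
      (Real.exp (n * ((empiricalMeasure x).real B - ν.real B) ^ 2))
        ∂(Measure.pi fun _ => ν) ≤ 2 := by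
  have hn : (0 : ℝ) < n := by exact_mod_cast Nat.pos_of_ne_zero (NeZero.ne n)
  let f : ℝ → ℝ := fun y => B.indicator 1 y - ν.real B
  have hf : Measurable f := (measurable_one.indicator hB).sub_const _
  have hY : HasSubgaussianMGF f ((‖(1 : ℝ) - 0‖₊ / 2) ^ 2) ν := by
    have := hasSubgaussianMGF_of_mem_Icc (μ := ν) (X := B.indicator 1) (a := 0) (b := 1)
      (measurable_one.indicator hB).aemeasurable (ae_of_all _ fun y => by
        by_cases h : y ∈ B <;> simp [h])
    simpa [integral_indicator_one hB] using this
  have hind : iIndepFun (fun i (x : Fin n → ℝ) => f (x i)) (Measure.pi fun _ => ν) :=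
    iIndepFun_pi fun _ => hf.aemeasurable
  have hmarg : ∀ i, HasSubgaussianMGF (fun x : Fin n → ℝ => f (x i))
      ((‖(1 : ℝ) - 0‖₊ / 2) ^ 2) (Measure.pi fun _ => ν) := fun i => by
    refine HasSubgaussianMGF.of_map (Y := fun x : Fin n → ℝ => x i) (X := f)
      (measurable_pi_apply i).aemeasurable ?_
    rwa [(measurePreserving_eval (fun _ : Fin n => ν) i).map_eq]
  have hsum := HasSubgaussianMGF.sum_of_iIndepFun hind
    (s := Finset.univ) (fun i _ => hmarg i)
  -- The sum has variance proxy `n/4`, so `s² = 2/n` meets `c s² ≤ 1/2` with equality, and `(s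
  -- Y)²/2` is `n` times the squared deviation of the mean.
  have key := hsum.lintegral_exp_sq_le (by fun_prop) (s := √(2 / n)) (by
    rw [Real.sq_sqrt (by positivity)]
    simp
    field_simp
    norm_num)
  refine le_trans (le_of_eq (lintegral_congr fun x => ?_)) key
  rw [empiricalMeasure_real_apply x hB, mul_pow, Real.sq_sqrt (by positivity),
    Finset.sum_sub_distrib]
  congr 2
  simp
  field_simp

/-! ### Averaging the deviation over levels. -/

theorem measurable_tailProb {u : ℝ → ℝ} (ν : Measure ℝ) [IsFiniteMeasure ν] :
    Measurable fun z => ν.real {y | z < u y} :=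
  Antitone.measurable fun _ _ hz => measureReal_mono fun _ hy => hz.trans_lt hy

theorem abs_measureReal_sub_le_one {Ω : Type*} [MeasurableSpace Ω] (P Q : Measure Ω)
    [IsProbabilityMeasure P] [IsProbabilityMeasure Q] (B : Set Ω) :
    |P.real B - Q.real B| ≤ 1 := by
  rw [abs_le]
  constructor <;>
    linarith [measureReal_nonneg (μ := P) (s := B), measureReal_nonneg (μ := Q) (s := B),
      measureReal_le_one (μ := P) (s := B), measureReal_le_one (μ := Q) (s := B)]

theorem convexOn_exp_mul_rpow {c p : ℝ} (hc : 0 ≤ c) (hp : 1 ≤ p) :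
    ConvexOn ℝ (Ici 0) fun x : ℝ => Real.exp (c * x ^ p) := by
  have h1 : ConvexOn ℝ (Ici 0) fun x : ℝ => c * x ^ p := by
    simpa using (convexOn_rpow hp).smul hc
  refine ⟨h1.1, fun x hx y hy a b ha hb hab => ?_⟩
  exact (Real.exp_le_exp.2 (h1.2 hx hy ha hb hab)).trans
    (convexOn_exp.2 (mem_univ _) (mem_univ _) ha hb hab)

/-- Joint measurability in sample and level is what exchanging the two integrals requires. -/
theorem measurable_empiricalMeasure_tailProb_sub {n : ℕ} (ν : Measure ℝ) [IsFiniteMeasure ν]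
    {u : ℝ → ℝ} (hu : Measurable u) :
    Measurable fun q : (Fin n → ℝ) × ℝ =>
      (empiricalMeasure q.1).real {y | q.2 < u y} - ν.real {y | q.2 < u y} := by
  have he : ∀ q : (Fin n → ℝ) × ℝ, (empiricalMeasure q.1).real {y | q.2 < u y}
      = (n : ℝ)⁻¹ * ∑ i, {r : (Fin n → ℝ) × ℝ | r.2 < u (r.1 i)}.indicator 1 q := fun q => by
    rw [empiricalMeasure_real_apply _ (measurableSet_lt measurable_const hu)]
    rfl
  have h1 : ∀ i, Measurable fun q : (Fin n → ℝ) × ℝ =>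
      {r : (Fin n → ℝ) × ℝ | r.2 < u (r.1 i)}.indicator (1 : (Fin n → ℝ) × ℝ → ℝ) q := fun i =>
    measurable_one.indicator (measurableSet_lt measurable_snd (by fun_prop))
  have h2 : Measurable fun q : (Fin n → ℝ) × ℝ => ν.real {y | q.2 < u y} :=
    (measurable_tailProb ν).comp measurable_snd
  simp_rw [he]
  fun_prop

/-- If a bounded random field has square-exponential moments uniformly over the levels, then so
does its average over the levels. -/
theorem measure_integral_abs_rpow_ge_le {Ω : Type*} [MeasurableSpace Ω] {Q : Measure Ω}
    [SFinite Q] {P : Measure ℝ} [IsProbabilityMeasure P] {g : Ω × ℝ → ℝ} (hg : Measurable g)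
    (hg1 : ∀ q, |g q| ≤ 1) {c : ℝ} (hc : 0 ≤ c)
    (hexp : ∀ z, ∫⁻ x, ENNReal.ofReal (Real.exp (c * g (x, z) ^ 2)) ∂Q ≤ 2) {α η : ℝ}
    (hα : 0 < α) (hα2 : α ≤ 2) (hη : 0 ≤ η) :
    Q {x | η ≤ ∫ z, |g (x, z)| ^ α ∂P}
      ≤ ENNReal.ofReal (2 * Real.exp (-(c * η ^ (2 / α)))) := by
  have hgx : ∀ x, Measurable fun z => g (x, z) := fun x => hg.comp measurable_prodMk_left
  have hF : Measurable fun q : Ω × ℝ => ENNReal.ofReal (Real.exp (c * g q ^ 2)) := by fun_prop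
  have hYm : Measurable fun x => ∫⁻ z, ENNReal.ofReal (Real.exp (c * g (x, z) ^ 2)) ∂P :=
    hF.lintegral_prod_right'
  have hYint : ∫⁻ x, ∫⁻ z, ENNReal.ofReal (Real.exp (c * g (x, z) ^ 2)) ∂P ∂Q ≤ 2 := by
    rw [lintegral_lintegral_swap hF.aemeasurable]
    exact (lintegral_mono hexp).trans (by simp)
  have hsub : {x | η ≤ ∫ z, |g (x, z)| ^ α ∂P}
      ⊆ {x | ENNReal.ofReal (Real.exp (c * η ^ (2 / α)))
          ≤ ∫⁻ z, ENNReal.ofReal (Real.exp (c * g (x, z) ^ 2)) ∂P} := by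
    intro x hx
    have hx' : η ≤ ∫ z, |g (x, z)| ^ α ∂P := hx
    have hgm := hgx x
    have hpow : ∀ z, (|g (x, z)| ^ α) ^ (2 / α) = g (x, z) ^ 2 := fun z => by
      rw [← Real.rpow_mul (abs_nonneg _), mul_div_cancel₀ _ hα.ne']
      simp
    have hi1 : Integrable (fun z => |g (x, z)| ^ α) P :=
      Integrable.of_bound (by fun_prop : Measurable fun z => |g (x, z)| ^ α).aestronglyMeasurable 1 (ae_of_all _ fun z => by
        rw [Real.norm_of_nonneg (by positivity)]
        exact Real.rpow_le_one (abs_nonneg _) (hg1 _) hα.le)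
    have hi2 : Integrable (fun z => Real.exp (c * g (x, z) ^ 2)) P :=
      Integrable.of_bound
        (by fun_prop : Measurable fun z => Real.exp (c * g (x, z) ^ 2)).aestronglyMeasurable (Real.exp (c * 1)) (ae_of_all _ fun z => by
        rw [Real.norm_of_nonneg (by positivity)]
        gcongr
        exact (sq_le_one_iff_abs_le_one _).2 (hg1 _))
    have hcont : Continuous fun y : ℝ => Real.exp (c * y ^ (2 / α)) := by
      have := Real.continuous_rpow_const (q := 2 / α) (by positivity)
      fun_prop
    -- Jensen's inequality over the levels; `α ≤ 2` makes the exponent `2/α` at least `1`, hence the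
    -- function convex.
    have hJ := (convexOn_exp_mul_rpow (p := 2 / α) hc
      (by rwa [le_div_iff₀ hα, one_mul])).map_integral_le (μ := P) (f := fun z => |g (x, z)| ^ α)
      hcont.continuousOn isClosed_Ici
      (ae_of_all _ fun z => by simp only [mem_Ici]; positivity) hi1
      (by simpa only [Function.comp_def, hpow] using hi2)
    simp only [hpow] at hJ
    rw [mem_ofPred_eq,
      ← ofReal_integral_eq_lintegral_ofReal hi2 (ae_of_all _ fun z => (Real.exp_pos _).le)]
    refine ENNReal.ofReal_le_ofReal (le_trans ?_ hJ)
    gcongr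
  refine (measure_mono hsub).trans ?_
  refine (meas_ge_le_lintegral_div hYm.aemeasurable (by simp [Real.exp_pos])
    ENNReal.ofReal_ne_top).trans ?_
  rw [Real.exp_neg, ENNReal.ofReal_mul (by norm_num),
    ENNReal.ofReal_inv_of_pos (Real.exp_pos _), ← div_eq_mul_inv]
  gcongr
  simpa using hYint

/-- Concentration of the empirical tail function around the tail function, averaged over levels in
`(0, A)`. -/
theorem measure_integral_abs_tailProb_sub_rpow_ge_le {n : ℕ} [NeZero n] (ν : Measure ℝ)
    [IsProbabilityMeasure ν] {u : ℝ → ℝ} (hu : Measurable u) {α A η : ℝ} (hα : 0 < α)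
    (hα2 : α ≤ 2) (hA : 0 < A) (hη : 0 ≤ η) :
    (Measure.pi fun _ : Fin n => ν) {x | A * η ≤ ∫ z in Ioo 0 A,
        |(empiricalMeasure x).real {y | z < u y} - ν.real {y | z < u y}| ^ α}
      ≤ ENNReal.ofReal (2 * Real.exp (-(n * η ^ (2 / α)))) := by
  have hA0 : ENNReal.ofReal A ≠ 0 := by simpa using hA
  -- Jensen's inequality needs a probability measure, so Lebesgue measure on `(0, A)` is normalized;
  -- this is the factor `A` in front of `η`.
  have hP : IsProbabilityMeasure ((ENNReal.ofReal A)⁻¹ • volume.restrict (Ioo 0 A)) := ⟨by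
    simp [ENNReal.inv_mul_cancel hA0 ENNReal.ofReal_ne_top]⟩
  have h1 : ∀ q : (Fin n → ℝ) × ℝ,
      |(empiricalMeasure q.1).real {y | q.2 < u y} - ν.real {y | q.2 < u y}| ≤ 1 :=
    fun q => abs_measureReal_sub_le_one _ _ _
  have h2 := fun z : ℝ => lintegral_exp_sq_empiricalMeasure_sub_le (n := n) ν
    (measurableSet_lt (measurable_const (a := z)) hu)
  have h3 := measure_integral_abs_rpow_ge_le
    (P := (ENNReal.ofReal A)⁻¹ • volume.restrict (Ioo 0 A))
    (measurable_empiricalMeasure_tailProb_sub ν hu) h1 (Nat.cast_nonneg n) h2 hα hα2 hη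
  simpa only [integral_smul_measure, ENNReal.toReal_inv, ENNReal.toReal_ofReal hA.le, smul_eq_mul,
    ← div_eq_inv_mul, le_div_iff₀' hA] using h3

/-! ### Weighted tails and the truncation error. -/

section WeightedTail

variable {u w : ℝ → ℝ} {α L : ℝ}

theorem measureReal_mem_Icc (ν : Measure ℝ) [IsProbabilityMeasure ν] (B : Set ℝ) :
    ν.real B ∈ Icc (0 : ℝ) 1 :=
  ⟨measureReal_nonneg, measureReal_le_one⟩

theorem weightedTail_nonneg (hw : IsWeightFunction w α L) (ν : Measure ℝ)
    [IsProbabilityMeasure ν] (z : ℝ) : 0 ≤ weightedTail u w ν z :=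
  (hw.mapsTo (measureReal_mem_Icc ν _)).1

theorem weightedTail_le_one (hw : IsWeightFunction w α L) (ν : Measure ℝ)
    [IsProbabilityMeasure ν] (z : ℝ) : weightedTail u w ν z ≤ 1 :=
  (hw.mapsTo (measureReal_mem_Icc ν _)).2

theorem measurable_weightedTail (hw : IsWeightFunction w α L) (ν : Measure ℝ)
    [IsProbabilityMeasure ν] : Measurable (weightedTail u w ν) :=
  Antitone.measurable fun _ _ hz => hw.monotoneOn (measureReal_mem_Icc ν _)
    (measureReal_mem_Icc ν _) (measureReal_mono fun _ hy => lt_of_le_of_lt hz hy)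

/-- Linear growth of `u` forces `|y| ≥ z/K` when `u y > z`, and the Hölder bound against `w 0 = 0`
raises the sub-Gaussian tail to the power `α`. -/
theorem weightedTail_le_exp {k K σ : ℝ} (hL : 0 < L) (hα : 0 < α) (hα1 : α < 1)
    (hu : IsTruncatableUtility u k K) (hw : IsWeightFunction w α L) (ν : Measure ℝ)
    [IsProbabilityMeasure ν]
    (htail : ∀ t > 0, ν.real {y | t ≤ |y|} ≤ 2 * Real.exp (-t ^ 2 / (2 * σ ^ 2)))
    {z : ℝ} (hz : 0 < z) :
    weightedTail u w ν z ≤ 2 * L * Real.exp (-(α / (2 * σ ^ 2 * K ^ 2)) * z ^ 2) := by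
  have hK : 0 < K := hu.lower_pos.trans_le hu.lower_le_upper
  have hp : ν.real {y | z < u y} ≤ 2 * Real.exp (-(z / K) ^ 2 / (2 * σ ^ 2)) := by
    refine le_trans (measureReal_mono fun y hy => ?_) (htail (z / K) (by positivity))
    rw [mem_ofPred_eq, div_le_iff₀ hK, mul_comm]
    exact (lt_of_lt_of_le hy (hu.le_mul_abs y)).le
  have h1 := hw.holder _ (measureReal_mem_Icc ν {y | z < u y}) 0 (by simp)
  rw [hw.map_zero, sub_zero, sub_zero, abs_of_nonneg measureReal_nonneg] at h1
  refine (le_abs_self _).trans (h1.trans ?_)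
  rw [mul_comm 2 L, mul_assoc]
  refine mul_le_mul_of_nonneg_left ?_ hL.le
  refine (Real.rpow_le_rpow measureReal_nonneg hp hα.le).trans ?_
  rw [Real.mul_rpow (by norm_num) (Real.exp_pos _).le, ← Real.exp_mul]
  have h2 : (2 : ℝ) ^ α ≤ 2 := by
    simpa using Real.rpow_le_rpow_of_exponent_le (by norm_num : (1 : ℝ) ≤ 2) hα1.le
  have h3 : -(z / K) ^ 2 / (2 * σ ^ 2) * α = -(α / (2 * σ ^ 2 * K ^ 2)) * z ^ 2 := by
    field_simp
  rw [h3]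
  gcongr

theorem integrableOn_weightedTail {k K σ : ℝ} (hL : 0 < L) (hα : 0 < α) (hα1 : α < 1)
    (hσ : 0 < σ) (hu : IsTruncatableUtility u k K) (hw : IsWeightFunction w α L) (ν : Measure ℝ)
    [IsProbabilityMeasure ν]
    (htail : ∀ t > 0, ν.real {y | t ≤ |y|} ≤ 2 * Real.exp (-t ^ 2 / (2 * σ ^ 2))) :
    IntegrableOn (weightedTail u w ν) (Ioi 0) := by
  have hK : 0 < K := hu.lower_pos.trans_le hu.lower_le_upper
  refine Integrable.mono' (((integrable_exp_neg_mul_sq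
    (show 0 < α / (2 * σ ^ 2 * K ^ 2) by positivity)).const_mul (2 * L)).integrableOn (s := Ioi 0))
    (measurable_weightedTail hw ν).aestronglyMeasurable ?_
  filter_upwards [self_mem_ae_restrict measurableSet_Ioi] with z hz
  rw [Real.norm_of_nonneg (weightedTail_nonneg hw ν z)]
  exact weightedTail_le_exp hL hα hα1 hu hw ν htail hz

/-- For `z ≥ a ≥ 0` one has `z² ≥ a² + (z - a)²`; the first term factors out and the second is a
shifted Gaussian. -/
theorem setIntegral_exp_neg_mul_sq_Ici_le {a b : ℝ} (ha : 0 ≤ a) (hb : 0 < b) :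
    ∫ z in Ici a, Real.exp (-b * z ^ 2) ≤ Real.exp (-b * a ^ 2) * √(Real.pi / b) := by
  have hi := (integrable_exp_neg_mul_sq hb)
  have hs : Integrable fun z : ℝ => Real.exp (-b * (z - a) ^ 2) := hi.comp_sub_right a
  calc ∫ z in Ici a, Real.exp (-b * z ^ 2)
      ≤ ∫ z in Ici a, Real.exp (-b * a ^ 2) * Real.exp (-b * (z - a) ^ 2) := by
        refine setIntegral_mono_on hi.integrableOn (hs.const_mul _).integrableOn
          measurableSet_Ici fun z hz => ?_
        rw [← Real.exp_add]
        refine Real.exp_le_exp.2 ?_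
        have hz' : a ≤ z := hz
        nlinarith [mul_nonneg hb.le (mul_nonneg ha (sub_nonneg.2 hz'))]
    _ ≤ ∫ z, Real.exp (-b * a ^ 2) * Real.exp (-b * (z - a) ^ 2) :=
        setIntegral_le_integral (hs.const_mul _) (ae_of_all _ fun z => by positivity)
    _ = Real.exp (-b * a ^ 2) * √(Real.pi / b) := by
        rw [integral_const_mul,
          integral_sub_right_eq_self (fun z : ℝ => Real.exp (-b * z ^ 2)) a, integral_gaussian]

theorem setIntegral_weightedTail_Ici_le {k K σ : ℝ} (hL : 0 < L) (hα : 0 < α) (hα1 : α < 1)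
    (hσ : 0 < σ) (hu : IsTruncatableUtility u k K) (hw : IsWeightFunction w α L) (ν : Measure ℝ)
    [IsProbabilityMeasure ν]
    (htail : ∀ t > 0, ν.real {y | t ≤ |y|} ≤ 2 * Real.exp (-t ^ 2 / (2 * σ ^ 2)))
    {n : ℕ} (hn : 2 ≤ n) {a : ℝ} (ha : 0 < a) (hKa : K * (σ * √(Real.log n)) ≤ a) :
    ∫ z in Ici a, weightedTail u w ν z
      ≤ L * K * (2 * √(2 * Real.pi * σ ^ 2 / α) * (n : ℝ) ^ (-(α / 2))) := by
  have hK : 0 < K := hu.lower_pos.trans_le hu.lower_le_upper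
  have hn0 : (0 : ℝ) < n := by positivity
  have hlog : 0 ≤ Real.log n := Real.log_natCast_nonneg n
  have hb : 0 < α / (2 * σ ^ 2 * K ^ 2) := by positivity
  have hsub : Ici a ⊆ Ioi 0 := fun z hz => ha.trans_le hz
  have h1 : ∫ z in Ici a, weightedTail u w ν z
      ≤ ∫ z in Ici a, 2 * L * Real.exp (-(α / (2 * σ ^ 2 * K ^ 2)) * z ^ 2) :=
    setIntegral_mono_on ((integrableOn_weightedTail hL hα hα1 hσ hu hw ν htail).mono_set hsub)
      ((integrable_exp_neg_mul_sq hb).const_mul _).integrableOn measurableSet_Ici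
      fun z hz => weightedTail_le_exp hL hα hα1 hu hw ν htail (hsub hz)
  refine h1.trans ?_
  rw [integral_const_mul]
  refine (mul_le_mul_of_nonneg_left (setIntegral_exp_neg_mul_sq_Ici_le ha.le hb)
    (by positivity)).trans ?_
  have h2 : √(Real.pi / (α / (2 * σ ^ 2 * K ^ 2))) = K * √(2 * Real.pi * σ ^ 2 / α) := by
    rw [← Real.sqrt_sq hK.le, ← Real.sqrt_mul (by positivity), Real.sqrt_sq hK.le]
    congr 1
    field_simp
  have h3 : Real.exp (-(α / (2 * σ ^ 2 * K ^ 2)) * a ^ 2) ≤ (n : ℝ) ^ (-(α / 2)) := by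
    rw [Real.rpow_def_of_pos hn0]
    refine Real.exp_le_exp.2 ?_
    have h4 : (K * (σ * √(Real.log n))) ^ 2 ≤ a ^ 2 := by gcongr
    rw [mul_pow, mul_pow, Real.sq_sqrt hlog] at h4
    have h5 := mul_le_mul_of_nonneg_left h4 hb.le
    have h6 : α / (2 * σ ^ 2 * K ^ 2) * (K ^ 2 * (σ ^ 2 * Real.log n))
        = Real.log n * (α / 2) := by
      field_simp
    linarith
  rw [h2]
  calc _ ≤ 2 * L * ((n : ℝ) ^ (-(α / 2)) * (K * √(2 * Real.pi * σ ^ 2 / α))) := by gcongr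
    _ = _ := by ring

/-- Below `a` clipping does not change the event `u > z`; from `a` on the event is empty and `w 0 =
0`. -/
theorem setIntegral_weightedTail_truncateDistribution (hw : IsWeightFunction w α L)
    (hu : Measurable u) {τ a : ℝ}
    (hclip : ∀ x, u (max (-τ) (min τ x)) = min (u x) a) (ρ : Measure ℝ) :
    ∫ z in Ioi 0, weightedTail u w (truncateDistribution τ ρ) z
      = ∫ z in Ioo 0 a, weightedTail u w ρ z := by
  have hm : Measurable fun x : ℝ => max (-τ) (min τ x) := by fun_prop
  have h : weightedTail u w (truncateDistribution τ ρ)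
      = (Iio a).indicator (weightedTail u w ρ) := by
    ext z
    have hpre : (fun x : ℝ => max (-τ) (min τ x)) ⁻¹' {x | z < u x}
        = {x | z < u x ∧ z < a} := by
      ext x
      simp [hclip]
    rw [weightedTail, truncateDistribution,
      map_measureReal_apply hm (measurableSet_lt measurable_const hu), hpre]
    by_cases hz : z < a
    · simp [hz, weightedTail]
    · simp [hz, hw.map_zero]
  rw [h, setIntegral_indicator measurableSet_Iio, Ioi_inter_Iio]

/-- Error of a truncated plug-in estimate of one of the two integrals in the CPT-value. -/
theorem abs_setIntegral_weightedTail_truncateDistribution_sub_le {k K σ τ : ℝ} (hL : 0 < L)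
    (hα : 0 < α) (hα1 : α < 1) (hσ : 0 < σ) (hu : IsTruncatableUtility u k K)
    (hw : IsWeightFunction w α L) (ν ρ : Measure ℝ) [IsProbabilityMeasure ν]
    [IsProbabilityMeasure ρ]
    (htail : ∀ t > 0, ν.real {y | t ≤ |y|} ≤ 2 * Real.exp (-t ^ 2 / (2 * σ ^ 2)))
    {n : ℕ} (hn : 2 ≤ n) (hτ : 0 < τ) (hKτ : K * (σ * √(Real.log n)) ≤ k * τ) :
    |(∫ z in Ioi 0, weightedTail u w (truncateDistribution τ ρ) z)
        - ∫ z in Ioi 0, weightedTail u w ν z|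
      ≤ L * (∫ z in Ioo 0 (K * τ), |ρ.real {y | z < u y} - ν.real {y | z < u y}| ^ α)
        + L * K * (2 * √(2 * Real.pi * σ ^ 2 / α) * (n : ℝ) ^ (-(α / 2))) := by
  obtain ⟨a, ha1, ha2, hclip⟩ := hu.clip τ hτ
  have ha : 0 < a := (mul_pos hu.lower_pos hτ).trans_le ha1
  rw [setIntegral_weightedTail_truncateDistribution hw hu.continuous.measurable hclip]
  have hint := integrableOn_weightedTail hL hα hα1 hσ hu hw ν htail
  have hsplit : ∫ z in Ioi 0, weightedTail u w ν z
      = (∫ z in Ioo 0 a, weightedTail u w ν z) + ∫ z in Ici a, weightedTail u w ν z := by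
    rw [← setIntegral_union (by
      rw [Set.disjoint_left]
      exact fun z hz hz' => absurd hz.2 (not_lt.2 hz')) measurableSet_Ici
      (hint.mono_set Ioo_subset_Ioi_self) (hint.mono_set fun z hz => ha.trans_le hz),
      Ioo_union_Ici_eq_Ioi ha]
  have hfin : ∀ (b : ℝ) (ρ' : Measure ℝ) [IsProbabilityMeasure ρ'],
      IntegrableOn (weightedTail u w ρ') (Ioo 0 b) := fun b ρ' _ =>
    Integrable.of_bound (measurable_weightedTail hw ρ').aestronglyMeasurable 1
      (ae_of_all _ fun z => by
        rw [Real.norm_of_nonneg (weightedTail_nonneg hw ρ' z)]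
        exact weightedTail_le_one hw ρ' z)
  have hgm : Measurable fun z => |ρ.real {y | z < u y} - ν.real {y | z < u y}| ^ α := by
    have h1 := measurable_tailProb (u := u) ρ
    have h2 := measurable_tailProb (u := u) ν
    fun_prop
  have hgi : ∀ b : ℝ, IntegrableOn
      (fun z => |ρ.real {y | z < u y} - ν.real {y | z < u y}| ^ α) (Ioo 0 b) := fun b =>
    Integrable.of_bound hgm.aestronglyMeasurable 1 (ae_of_all _ fun z => by
      rw [Real.norm_of_nonneg (by positivity)]
      exact Real.rpow_le_one (abs_nonneg _) (abs_measureReal_sub_le_one _ _ _) hα.le)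
  have hmain : |(∫ z in Ioo 0 a, weightedTail u w ρ z) - ∫ z in Ioo 0 a, weightedTail u w ν z|
      ≤ L * ∫ z in Ioo 0 (K * τ), |ρ.real {y | z < u y} - ν.real {y | z < u y}| ^ α := by
    rw [← integral_sub (hfin a ρ) (hfin a ν)]
    calc _ ≤ ∫ z in Ioo 0 a, |weightedTail u w ρ z - weightedTail u w ν z| :=
          abs_integral_le_integral_abs
      _ ≤ ∫ z in Ioo 0 a, L * |ρ.real {y | z < u y} - ν.real {y | z < u y}| ^ α :=
          integral_mono ((hfin a ρ).sub (hfin a ν)).abs ((hgi a).const_mul L) fun z =>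
            hw.holder _ (measureReal_mem_Icc ρ _) _ (measureReal_mem_Icc ν _)
      _ = L * ∫ z in Ioo 0 a, |ρ.real {y | z < u y} - ν.real {y | z < u y}| ^ α :=
          integral_const_mul _ _
      -- The cutoff `a` is replaced by the explicit level `K τ`.
      _ ≤ _ := by
          refine mul_le_mul_of_nonneg_left (setIntegral_mono_set (hgi _)
            (ae_of_all _ fun z => ?_) (Ioo_subset_Ioo_right ha2).eventuallyLE) hL.le
          simp only [Pi.zero_apply]
          positivity
  have hrest := setIntegral_weightedTail_Ici_le hL hα hα1 hσ hu hw ν htail hn ha (hKτ.trans ha1)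
  have hrest0 : 0 ≤ ∫ z in Ici a, weightedTail u w ν z :=
    integral_nonneg fun z => weightedTail_nonneg hw ν z
  rw [hsplit, ← sub_sub]
  refine (abs_sub _ _).trans (add_le_add hmain ?_)
  rwa [abs_of_nonneg hrest0]

end WeightedTail

/-! ### The bias term and the final bound. -/

theorem half_le_log_natCast {n : ℕ} (hn : 2 ≤ n) : 1 / 2 ≤ Real.log n := by
  have h : Real.log 2 ≤ Real.log n := Real.log_le_log (by norm_num) (by exact_mod_cast hn)
  linarith [Real.log_two_gt_d9]

theorem cptBias_nonneg {L Kp Km α β : ℝ} (hL : 0 < L) (hKp : 0 < Kp) (hKm : 0 < Km) (hα : 0 < α)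
    (hα1 : α < 1) (hβ : 1 < β) {n : ℕ} : 0 ≤ cptBias L Kp Km α β n := by
  have h1 : 0 < 1 - α := by linarith
  have h2 : 0 < β - 1 := by linarith
  have h3 : 0 ≤ Real.log n := Real.log_natCast_nonneg n
  unfold cptBias
  positivity

theorem isBigO_cptBias {L Kp Km α β : ℝ} (hL : 0 < L) (hKp : 0 < Kp) (hKm : 0 < Km) (hα : 0 < α)
    (hα1 : α < 1) (hβ : 1 < β) :
    (fun n : ℕ => cptBias L Kp Km α β n)
      =O[Filter.atTop] (fun n : ℕ => (n : ℝ) ^ (-(α * (1 - α)))) := by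
  have h1 : 0 < 1 - α := by linarith
  have h2 : 0 < β - 1 := by linarith
  refine Asymptotics.IsBigO.of_bound (L * (Kp + Km) / (α * (1 - α) * (β - 1))) ?_
  -- From `n = 3` on, `log n ≥ 1`, so the logarithmic factor can be dropped.
  filter_upwards [Filter.eventually_ge_atTop 3] with n hn
  have hn0 : (0 : ℝ) < n := by positivity
  have hlog : 1 ≤ Real.log n := by
    rw [Real.le_log_iff_exp_le hn0]
    exact Real.exp_one_lt_three.le.trans (by exact_mod_cast hn)
  have hpow : 1 ≤ Real.log n ^ (β / (β - 1)) := Real.one_le_rpow hlog (by positivity)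
  rw [Real.norm_of_nonneg (cptBias_nonneg hL hKp hKm hα hα1 hβ),
    Real.norm_of_nonneg (by positivity), cptBias, Real.rpow_neg hn0.le, ← div_eq_mul_inv, div_div]
  have hden : α * (1 - α) * (β - 1)
      ≤ Real.log n ^ (β / (β - 1)) * (α * (1 - α)) * (β - 1) := by
    rw [mul_assoc (Real.log n ^ (β / (β - 1)))]
    exact le_mul_of_one_le_left (by positivity) hpow
  exact div_le_div_of_nonneg_left (by positivity) (by positivity)
    (mul_le_mul_of_nonneg_right hden (by positivity))

/-- Applied to `x = log n` and `p = 1/β`. The factor `2` covers `n = 2`, where `log n < 1`. -/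
theorem half_le_rpow_and_sqrt_le {x p : ℝ} (hx : 1 / 2 ≤ x) (hp : 1 / 2 ≤ p) (hp1 : p ≤ 1) :
    1 / 2 ≤ x ^ p ∧ √x ≤ 2 * x ^ p := by
  have hx0 : 0 < x := by linarith
  rcases le_total 1 x with h | h
  · have h1 : 1 ≤ x ^ p := Real.one_le_rpow h (by linarith)
    have h2 : √x ≤ x ^ p := by
      rw [Real.sqrt_eq_rpow]
      exact Real.rpow_le_rpow_of_exponent_le h hp
    constructor <;> linarith
  · have h1 : x ≤ x ^ p := by
      simpa using Real.rpow_le_rpow_of_exponent_ge hx0 h hp1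
    have h2 : √x ≤ 1 := by simpa using Real.sqrt_le_sqrt h
    constructor <;> linarith

/-- Concentration of the truncated CPT-value estimator around the CPT-value, for deviations that
exceed twice the truncation error. -/
theorem measureReal_lt_abs_cptEstimator_sub_le {L kp Kp km Km σ α τ ε : ℝ}
    {up um wp wm : ℝ → ℝ} (hL : 0 < L) (hα : 0 < α) (hα1 : α < 1) (hσ : 0 < σ)
    (hup : IsTruncatableUtility up kp Kp) (hum : IsTruncatableUtility um km Km)
    (hwp : IsWeightFunction wp α L) (hwm : IsWeightFunction wm α L)
    (ν : Measure ℝ) [IsProbabilityMeasure ν]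
    (htail : ∀ t > 0, ν.real {y | t ≤ |y|} ≤ 2 * Real.exp (-t ^ 2 / (2 * σ ^ 2)))
    {Ω : Type*} [MeasurableSpace Ω] {μ : Measure Ω} [IsProbabilityMeasure μ] {n : ℕ} (hn : 2 ≤ n)
    {S : Fin n → Ω → ℝ} (hS : ∀ i, AEMeasurable (S i) μ)
    (hlaw : μ.map (fun ω i => S i ω) = Measure.pi fun _ => ν) (hτ : 0 < τ)
    (hKp : Kp * (σ * √(Real.log n)) ≤ kp * τ) (hKm : Km * (σ * √(Real.log n)) ≤ km * τ)
    (hε : 2 * (L * (Kp + Km) * (2 * √(2 * Real.pi * σ ^ 2 / α) * (n : ℝ) ^ (-(α / 2)))) < ε) :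
    μ.real {ω | ε < |cptEstimator up um wp wm τ (fun i => S i ω) - cptValue up um wp wm ν|}
      ≤ 4 * Real.exp (-(n * (ε / (2 * L * τ * (Kp + Km))) ^ (2 / α))) := by
  have hn0 : NeZero n := ⟨by omega⟩
  have hKp0 : 0 < Kp := hup.lower_pos.trans_le hup.lower_le_upper
  have hKm0 : 0 < Km := hum.lower_pos.trans_le hum.lower_le_upper
  have hε0 : 0 < ε := lt_of_le_of_lt (by positivity) hε
  -- Chosen so that the two fluctuation terms together amount to `ε/2`.
  set η := ε / (2 * L * τ * (Kp + Km)) with hη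
  have hη0 : 0 ≤ η := by positivity
  let I : (ℝ → ℝ) → ℝ → (Fin n → ℝ) → ℝ := fun u K x => ∫ z in Ioo 0 (K * τ),
    |(empiricalMeasure x).real {y | z < u y} - ν.real {y | z < u y}| ^ α
  have hprob : ∀ (u : ℝ → ℝ) (K : ℝ), Measurable u → 0 < K →
      μ {ω | K * τ * η ≤ I u K (fun i => S i ω)}
        ≤ ENNReal.ofReal (2 * Real.exp (-(n * η ^ (2 / α)))) := fun u K hu hK => by
    -- This inequality holds for arbitrary sets, so the event need not be shown measurable.
    have h := Measure.le_map_apply (μ := μ) (f := fun ω i => S i ω)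
      (aemeasurable_pi_lambda _ hS) {x | K * τ * η ≤ I u K x}
    rw [hlaw] at h
    exact h.trans (measure_integral_abs_tailProb_sub_rpow_ge_le ν hu hα (by linarith)
      (by positivity) hη0)
  have hsub : {ω | ε < |cptEstimator up um wp wm τ (fun i => S i ω) - cptValue up um wp wm ν|}
      ⊆ {ω | Kp * τ * η ≤ I up Kp (fun i => S i ω)}
        ∪ {ω | Km * τ * η ≤ I um Km (fun i => S i ω)} := by
    intro ω hω
    by_contra hcon
    rw [mem_union, not_or] at hcon
    obtain ⟨hp, hm⟩ := hcon
    rw [mem_ofPred_eq, not_le] at hp hm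
    rw [mem_ofPred_eq, cptEstimator, cptValue, cptValue, sub_sub_sub_comm] at hω
    have h1 := abs_setIntegral_weightedTail_truncateDistribution_sub_le hL hα hα1 hσ hup hwp ν
      (empiricalMeasure fun i => S i ω) htail hn hτ hKp
    have h2 := abs_setIntegral_weightedTail_truncateDistribution_sub_le hL hα hα1 hσ hum hwm ν
      (empiricalMeasure fun i => S i ω) htail hn hτ hKm
    have h3 := (hω.trans_le (abs_sub _ _)).trans_le (add_le_add h1 h2)
    have h4 := mul_lt_mul_of_pos_left (add_lt_add hp hm) hL
    have h5 : L * (Kp * τ * η + Km * τ * η) = ε / 2 := by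
      rw [hη]
      field_simp
    simp only [I] at h4
    linarith
  rw [measureReal_def]
  refine ENNReal.toReal_le_of_le_ofReal (by positivity) ?_
  refine ((measure_mono hsub).trans (measure_union_le _ _)).trans ((add_le_add
    (hprob up Kp hup.continuous.measurable hKp0) (hprob um Km hum.continuous.measurable hKm0)).trans
    (le_of_eq ?_))
  rw [← ENNReal.ofReal_add (by positivity) (by positivity)]
  congr 1
  ring

theorem mainTheorem11 (σ α : ℝ) (hσ : 0 < σ) (hα : 0 < α) (hα1 : α < 1) :
    ∃ c₁ > 0, ∃ c₂ > 0,
      ∀ (L kp Kp km Km β : ℝ) (up um wp wm : ℝ → ℝ),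
        0 < L → 1 < β → β ≤ 2 →
        IsGainUtility up kp Kp → IsLossUtility um km Km →
        IsWeightFunction wp α L → IsWeightFunction wm α L →
      -- polynomial decay of the bias term
      (fun n : ℕ => cptBias L Kp Km α β n)
          =O[Filter.atTop] (fun n : ℕ => (n : ℝ) ^ (-(α * (1 - α)))) ∧
      ∀ {Ω₀ : Type*} [MeasurableSpace Ω₀] (μ₀ : Measure Ω₀) [IsProbabilityMeasure μ₀]
        (X : Ω₀ → ℝ), AEMeasurable X μ₀ → IsSubGaussian X μ₀ σ →
      -- the CPT-value `C(X)` is well defined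
      IntegrableOn (weightedTail up wp (μ₀.map X)) (Ioi 0) ∧
      IntegrableOn (weightedTail um wm (μ₀.map X)) (Ioi 0) ∧
      -- the concentration bound, for `n` i.i.d. samples of `X`
      ∀ {Ω : Type*} [MeasurableSpace Ω] (μ : Measure Ω) [IsProbabilityMeasure μ]
        (n : ℕ) (S : Fin n → Ω → ℝ),
        2 ≤ n → iIndepFun S μ → (∀ i, IdentDistrib (S i) X μ μ₀) →
      ∀ ε : ℝ, cptBias L Kp Km α β n < ε →
        μ.real {ω | ε < |cptEstimator up um wp wm (truncationLevel kp Kp km Km σ n)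
              (fun i => S i ω) - cptValue up um wp wm (μ₀.map X)|}
          ≤ c₁ * Real.exp (-(c₂ * n * ((ε - cptBias L Kp Km α β n) /
              (L * (Kp + Km) * max (Kp / kp) (Km / km) * Real.log n ^ (1 / β))) ^ (2 / α))) := by
  set B : ℝ := 2 * √(2 * Real.pi * σ ^ 2 / α)
  have hB0 : 0 < B := by positivity
  -- The base is the constant lost in `τ ≤ M (2 σ + 2) (log n)^(1/β)` and in halving `ε`.
  set c₂ : ℝ := (1 / (2 * (2 * σ + 2))) ^ (2 / α)
  have hc₂0 : 0 < c₂ := by positivity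
  refine ⟨4 * Real.exp (c₂ * (4 * B) ^ (2 / α)), by positivity, c₂, hc₂0, ?_⟩
  intro L kp Kp km Km β up um wp wm hL hβ hβ2 hgain hloss hwp hwm
  have hup := hgain.isTruncatableUtility
  have hum := hloss.isTruncatableUtility
  have hkp := hup.lower_pos
  have hkm := hum.lower_pos
  have hKp := hgain.upper_pos
  have hKm := hloss.upper_pos
  refine ⟨isBigO_cptBias hL hKp hKm hα hα1 hβ, ?_⟩
  intro Ω₀ _ μ₀ _ X hX hsG
  have hν : IsProbabilityMeasure (μ₀.map X) := Measure.isProbabilityMeasure_map hX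
  have htail : ∀ t > 0, (μ₀.map X).real {y | t ≤ |y|} ≤ 2 * Real.exp (-t ^ 2 / (2 * σ ^ 2)) := by
    intro t ht
    rw [measureReal_def, Measure.map_apply_of_aemeasurable hX
      (measurableSet_le measurable_const (by fun_prop))]
    exact hsG.tail t ht
  refine ⟨integrableOn_weightedTail hL hα hα1 hσ hup hwp _ htail,
    integrableOn_weightedTail hL hα hα1 hσ hum hwm _ htail, ?_⟩
  intro Ω _ μ _ n S hn hind hid ε hε
  have hn0 : (0 : ℝ) < n := by positivity
  have hlog := half_le_log_natCast hn
  obtain ⟨hℓ, hsqrt⟩ := half_le_rpow_and_sqrt_le (p := 1 / β) hlog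
    (by gcongr) (by rw [div_le_one (by linarith)]; exact hβ.le)
  have hc3 : 0 ≤ cptBias L Kp Km α β n := cptBias_nonneg hL hKp hKm hα hα1 hβ
  set c₃ := cptBias L Kp Km α β n
  set ℓ := Real.log n ^ (1 / β)
  have hM1 : 1 ≤ max (Kp / kp) (Km / km) :=
    le_max_of_le_left ((one_le_div hkp).2 hup.lower_le_upper)
  have hMp : Kp ≤ kp * max (Kp / kp) (Km / km) := by
    rw [← div_le_iff₀' hkp]
    exact le_max_left _ _
  have hMm : Km ≤ km * max (Kp / kp) (Km / km) := by
    rw [← div_le_iff₀' hkm]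
    exact le_max_right _ _
  rw [truncationLevel]
  set M := max (Kp / kp) (Km / km)
  have hM0 : 0 < M := by linarith
  have hℓ0 : 0 < ℓ := by linarith
  have hε0 : 0 < ε - c₃ := by linarith
  have hs0 : 0 ≤ σ * √(Real.log n) := by positivity
  set r := (ε - c₃) / (L * (Kp + Km) * M * ℓ) with hr
  have hr0 : 0 < r := by positivity
  -- The threshold is twice the truncation error. Below it, `n r^(2/α) ≤ (4 B)^(2/α)`, so the
  -- exponential factor in `c₁` makes the bound trivial.
  rcases le_or_gt ε (2 * (L * (Kp + Km) * (B * (n : ℝ) ^ (-(α / 2))))) with hsmall | hlarge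
  · have hr1 : r ≤ 4 * B * (n : ℝ) ^ (-(α / 2)) := by
      rw [hr, div_le_iff₀ (by positivity)]
      have hMℓ : 1 ≤ 2 * (M * ℓ) := by nlinarith
      have h1 := mul_le_mul_of_nonneg_left hMℓ
        (show 0 ≤ 2 * (L * (Kp + Km) * (B * (n : ℝ) ^ (-(α / 2)))) by positivity)
      nlinarith
    have hr2 : n * r ^ (2 / α) ≤ (4 * B) ^ (2 / α) := by
      calc n * r ^ (2 / α) ≤ n * (4 * B * (n : ℝ) ^ (-(α / 2))) ^ (2 / α) := by gcongr
        _ = n * ((4 * B) ^ (2 / α) * (n : ℝ)⁻¹) := by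
            rw [Real.mul_rpow (by positivity) (by positivity), ← Real.rpow_mul hn0.le,
              show -(α / 2) * (2 / α) = -1 by field_simp, Real.rpow_neg_one]
        _ = (4 * B) ^ (2 / α) := by field_simp
    refine measureReal_le_one.trans ?_
    rw [mul_assoc, ← Real.exp_add]
    have h2 : 1 ≤ Real.exp (c₂ * (4 * B) ^ (2 / α) + -(c₂ * n * r ^ (2 / α))) := by
      refine Real.one_le_exp ?_
      nlinarith [mul_le_mul_of_nonneg_left hr2 hc₂0.le]
    linarith
  · have hτ0 : 0 < M * (σ * √(Real.log n) + 1) := by positivity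
    have hτ : M * (σ * √(Real.log n) + 1) ≤ M * ((2 * σ + 2) * ℓ) := by
      refine mul_le_mul_of_nonneg_left ?_ hM0.le
      nlinarith
    have hKτ : ∀ k K : ℝ, 0 < K → K ≤ k * M →
        K * (σ * √(Real.log n)) ≤ k * (M * (σ * √(Real.log n) + 1)) := fun k K hK h => by
      rw [← mul_assoc k]
      exact mul_le_mul h (by linarith) hs0 (hK.le.trans h)
    have hlaw : μ.map (fun ω i => S i ω) = Measure.pi fun _ => μ₀.map X := by
      rw [hind.map_fun_eq_pi_map fun i => (hid i).aemeasurable_fst]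
      simp_rw [(hid _).map_eq]
    refine (measureReal_lt_abs_cptEstimator_sub_le hL hα hα1 hσ hup hum hwp hwm _ htail hn
      (fun i => (hid i).aemeasurable_fst) hlaw hτ0 (hKτ kp Kp hKp hMp) (hKτ km Km hKm hMm)
      hlarge).trans ?_
    have h4 : (4 : ℝ) ≤ 4 * Real.exp (c₂ * (4 * B) ^ (2 / α)) := by
      linarith [Real.one_le_exp (show 0 ≤ c₂ * (4 * B) ^ (2 / α) by positivity)]
    refine mul_le_mul h4 (Real.exp_le_exp.2 (neg_le_neg ?_)) (Real.exp_pos _).le (by positivity)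
    have hη : 1 / (2 * (2 * σ + 2)) * r
        ≤ ε / (2 * L * (M * (σ * √(Real.log n) + 1)) * (Kp + Km)) := by
      calc 1 / (2 * (2 * σ + 2)) * r
          = (ε - c₃) / (2 * L * (M * ((2 * σ + 2) * ℓ)) * (Kp + Km)) := by
            rw [hr]
            field_simp
        _ ≤ ε / (2 * L * (M * (σ * √(Real.log n) + 1)) * (Kp + Km)) := by
            gcongr <;> linarith
    calc c₂ * n * r ^ (2 / α) = n * (1 / (2 * (2 * σ + 2)) * r) ^ (2 / α) := by
          rw [Real.mul_rpow (by positivity) hr0.le]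
          ring
      _ ≤ _ := by gcongr
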